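/- Let $d$ be a positive integer, let $\mathbb T^d=(\mathbb R/2\pi\mathbb Z)^d$ carry the normalized Lebesgue measure $(2\pi)^{-d}\,d\mathbf x$, and let $\|f\|_1=(2\pi)^{-d}\int_{\mathbb T^d}|f(\mathbf x)|\,d\mathbf x$. For a finite set $Q\subset\mathbb Z^d$ let $\mathcal T(Q)$ be the space of all functions $f(\mathbf x)=\sum_{\mathbf k\in Q}c_{\mathbf k}e^{i(\mathbf k,\mathbf x)}$ with complex coefficients $c_{\mathbf k}$. There is a constant $C(d)>0$, depending only on $d$, such that for every integer $n\ge 1$ and every nonempty set $Q\subset \mathbb Z^d\cap[-2^n,2^n]^d$ there exist an integer $m\ge 1$ with $m\le C(d)\,|Q|\,n^{7/2}$ and $m$ distinct points $\xi^1,\dots,\xi^m\in\mathbb T^d$ such that for all $f\in\mathcal T(Q)$ $$\frac12\,\|f\|_1\le\frac1m\sum_{j=1}^m|f(\xi^j)|\le\frac32\,\|f\|_1 .$$ -/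

import Mathlib

open MeasureTheory

noncomputable section

namespace TrigDisc

instance factTwoPiPos : Fact (0 < 2 * Real.pi) := ⟨Real.two_pi_pos⟩

/-- The `d`-dimensional torus `(ℝ / 2πℤ)^d`. -/
abbrev Torus (d : ℕ) : Type := Fin d → AddCircle (2 * Real.pi)

/-- The normalized Lebesgue (Haar probability) measure on the torus, the image of
`(2π)^{-d} dx` on `[0, 2π)^d`. -/
def torusMeasure (d : ℕ) : Measure (Torus d) :=
  Measure.pi fun _ : Fin d => (AddCircle.haarAddCircle : Measure (AddCircle (2 * Real.pi)))

instance (d : ℕ) : IsProbabilityMeasure (torusMeasure d) := by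
  unfold torusMeasure; infer_instance

/-- The exponential `x ↦ e^{i(k,x)}` on the torus; see `character_coe`. -/
def character {d : ℕ} (k : Fin d → ℤ) (x : Torus d) : ℂ :=
  ∏ j, fourier (k j) (x j)

theorem character_coe {d : ℕ} (k : Fin d → ℤ) (x : Fin d → ℝ) :
    character k (fun j => ((x j : ℝ) : AddCircle (2 * Real.pi))) =
      Complex.exp (Complex.I * ∑ j, (k j : ℂ) * (x j : ℂ)) := by
  have hpi : (Real.pi : ℂ) ≠ 0 := Complex.ofReal_ne_zero.mpr Real.pi_ne_zero
  rw [character, Finset.mul_sum, Complex.exp_sum]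
  refine Finset.prod_congr rfl fun j _ => ?_
  rw [fourier_coe_apply]
  congr 1
  push_cast
  field_simp

/-- The space `𝒯(Q)` of complex trigonometric polynomials with frequencies in `Q`. -/
def trigPoly {d : ℕ} (Q : Finset (Fin d → ℤ)) : Set (Torus d → ℂ) :=
  {f | ∃ c : (Fin d → ℤ) → ℂ, ∀ x, f x = ∑ k ∈ Q, c k * character k x}

/-- The box `Π(N) = [-N_1, N_1] × ⋯ × [-N_d, N_d]` of integer frequencies. -/
def freqBox {d : ℕ} (N : Fin d → ℕ) : Set (Fin d → ℤ) :=
  {k | ∀ j, -(N j : ℤ) ≤ k j ∧ k j ≤ (N j : ℤ)}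

/-- The `L_1` norm with respect to the normalized measure. It is used here only for trigonometric
polynomials, which are continuous and therefore integrable. -/
def l1Norm {d : ℕ} (f : Torus d → ℂ) : ℝ :=
  ∫ x, ‖f x‖ ∂(torusMeasure d)

end TrigDisc

end

namespace TrigDisc

/-- The sign attached to a Boolean. -/
noncomputable def boolSign (b : Bool) : ℝ := if b then 1 else -1

@[simp] theorem boolSign_true : boolSign true = 1 := rfl

@[simp] theorem boolSign_false : boolSign false = -1 := by simp [boolSign]

@[simp] theorem boolSign_not (b : Bool) : boolSign (!b) = -boolSign b := by cases b <;> simp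

theorem abs_boolSign (b : Bool) : |boolSign b| = 1 := by cases b <;> simp

section Signs

variable {ι : Type*} [Fintype ι]

/-- The signed sum `∑ ±a i`. -/
noncomputable def signSum (ε : ι → Bool) (a : ι → ℝ) : ℝ := ∑ i, boolSign (ε i) * a i

theorem signSum_not (ε : ι → Bool) (a : ι → ℝ) : signSum (fun i => !ε i) a = -signSum ε a := by
  simp [signSum]

theorem signSum_const_mul (ε : ι → Bool) (c : ℝ) (a : ι → ℝ) :
    signSum ε (fun i => c * a i) = c * signSum ε a := by
  simp only [signSum, Finset.mul_sum]
  exact Finset.sum_congr rfl fun i _ => by ring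

theorem abs_signSum_le (ε : ι → Bool) (a : ι → ℝ) : |signSum ε a| ≤ ∑ i, |a i| := by
  refine (Finset.abs_sum_le_sum_abs _ _).trans_eq (Finset.sum_congr rfl fun i _ => ?_)
  rw [abs_mul, abs_boolSign, one_mul]

variable [DecidableEq ι]

theorem sum_exp_signSum_le (a : ι → ℝ) :
    ∑ ε : ι → Bool, Real.exp (signSum ε a) ≤
      Fintype.card (ι → Bool) * Real.exp ((∑ i, a i ^ 2) / 2) := by
  have h : ∑ ε : ι → Bool, Real.exp (signSum ε a) = ∏ i, (2 * Real.cosh (a i)) := by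
    have h2 : ∀ i, 2 * Real.cosh (a i) = ∑ b : Bool, Real.exp (boolSign b * a i) := fun i => by
      rw [Real.cosh_eq]; simp; ring
    simp only [h2, Finset.prod_univ_sum, Fintype.piFinset_univ, signSum, Real.exp_sum]
  rw [h, Finset.prod_mul_distrib, Finset.sum_div, Real.exp_sum]
  simp only [Finset.prod_const, Finset.card_univ, Fintype.card_pi, Fintype.card_bool]
  push_cast
  gcongr with i _
  exact Real.cosh_le_exp_half_sq _

/-- Maximal inequality for finitely many signed sums. -/
theorem sum_le_of_le_abs_signSum {Y : Type*} [Fintype Y] [Nonempty Y] (a : Y → ι → ℝ) {V : ℝ}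
    (hV : 0 < V) (ha : ∀ y, ∑ i, a y i ^ 2 ≤ V) (Z : (ι → Bool) → ℝ)
    (hZ : ∀ ε, ∃ y, Z ε ≤ |signSum ε (a y)|) :
    ∑ ε, Z ε ≤
      Fintype.card (ι → Bool) * Real.sqrt (2 * V * Real.log (2 * Fintype.card Y)) := by
  set c : ℝ := ((Fintype.card (ι → Bool) : ℕ) : ℝ)
  set M : ℝ := ((Fintype.card Y : ℕ) : ℝ) with hM
  have hc : 0 < c := by simp only [c]; exact_mod_cast Fintype.card_pos
  have hM1 : 1 ≤ M := by rw [hM]; exact_mod_cast Fintype.card_pos (α := Y)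
  set l := Real.log (2 * M) with hl
  have hl0 : 0 < l := Real.log_pos (by linarith)
  set t := Real.sqrt (2 * l / V) with ht
  have ht0 : 0 < t := Real.sqrt_pos.2 (by positivity)
  have ht2 : t ^ 2 = 2 * l / V := Real.sq_sqrt (by positivity)
  have htV : t ^ 2 * V / 2 = l := by rw [ht2]; field_simp
  have key : ∀ ε, t * Z ε - 2 * l + 1 ≤
      (∑ y, (Real.exp (signSum ε (fun i => t * a y i)) +
        Real.exp (signSum ε (fun i => (-t) * a y i)))) * Real.exp (-(2 * l)) := by
    intro ε
    obtain ⟨y, hy⟩ := hZ ε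
    refine (Real.add_one_le_exp _).trans ?_
    rw [sub_eq_add_neg, Real.exp_add]
    gcongr
    refine le_trans ?_ (Finset.single_le_sum (f := fun y =>
      (Real.exp (signSum ε (fun i => t * a y i)) +
        Real.exp (signSum ε (fun i => (-t) * a y i)))) (fun y _ => by positivity)
        (Finset.mem_univ y))
    simp only [signSum_const_mul]
    rcases abs_cases (signSum ε (a y)) with ⟨h, -⟩ | ⟨h, -⟩ <;> rw [h] at hy
    · have := Real.exp_le_exp.2 (mul_le_mul_of_nonneg_left hy ht0.le)
      have := Real.exp_pos (-t * signSum ε (a y))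
      linarith
    · have := Real.exp_le_exp.2 (mul_le_mul_of_nonneg_left hy ht0.le)
      rw [mul_neg, ← neg_mul] at this
      have := Real.exp_pos (t * signSum ε (a y))
      linarith
  have hexp : ∀ u : ℝ, u ^ 2 = t ^ 2 → ∀ y,
      ∑ ε, Real.exp (signSum ε (fun i => u * a y i)) ≤ c * Real.exp l := by
    intro u hu y
    refine (sum_exp_signSum_le _).trans ?_
    gcongr
    rw [← htV]
    simp only [mul_pow, ← Finset.mul_sum, hu]
    gcongr
    exact ha y
  have hsum := Finset.sum_le_sum fun ε (_ : ε ∈ Finset.univ) => key ε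
  rw [← Finset.sum_mul, Finset.sum_comm] at hsum
  have h2 : ∑ y, ∑ ε, (Real.exp (signSum ε (fun i => t * a y i)) +
        Real.exp (signSum ε (fun i => (-t) * a y i))) ≤ c * Real.exp (2 * l) := by
    calc _ ≤ ∑ y : Y, (c * Real.exp l + c * Real.exp l) := by
          refine Finset.sum_le_sum fun y _ => ?_
          rw [Finset.sum_add_distrib]
          exact add_le_add (hexp t rfl y) (hexp (-t) (by ring) y)
      _ = c * Real.exp (2 * l) := by
          rw [two_mul l, Real.exp_add]
          nth_rw 4 [hl]
          rw [Real.exp_log (by linarith)]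
          simp only [Finset.sum_const, Finset.card_univ, nsmul_eq_mul, ← hM]
          ring
  have h3 := hsum.trans (mul_le_mul_of_nonneg_right h2 (Real.exp_pos _).le)
  rw [mul_assoc, ← Real.exp_add, add_neg_cancel, Real.exp_zero] at h3
  simp only [Finset.sum_add_distrib, Finset.sum_sub_distrib, Finset.sum_const, Finset.card_univ,
    nsmul_eq_mul, ← Finset.mul_sum] at h3
  have h4 : t * ∑ ε, Z ε ≤ t * (c * Real.sqrt (2 * V * l)) := by
    have : t * Real.sqrt (2 * V * l) = 2 * l := by
      rw [ht, ← Real.sqrt_mul (by positivity)]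
      rw [show 2 * l / V * (2 * V * l) = (2 * l) ^ 2 by field_simp]
      exact Real.sqrt_sq (by positivity)
    calc _ ≤ c * (2 * l) := by simp only [c]; linarith
      _ = _ := by rw [← this]; ring
  exact le_of_mul_le_mul_left h4 ht0

/-- Flipping one sign. -/
theorem sum_update_not (i : ι) (F : (ι → Bool) → ℝ) :
    ∑ ε, F (Function.update ε i (!ε i)) = ∑ ε, F ε := by
  have h : Function.Involutive fun ε : ι → Bool => Function.update ε i (!ε i) := by
    intro ε
    simp
  exact Equiv.sum_comp (Function.Involutive.toPerm _ h) F

theorem signSum_update (ε : ι → Bool) (i : ι) (b : Bool) (a : ι → ℝ) :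
    signSum (Function.update ε i b) a =
      boolSign b * a i + ∑ j ∈ Finset.univ.erase i, boolSign (ε j) * a j := by
  rw [signSum, ← Finset.add_sum_erase _ _ (Finset.mem_univ i)]
  congr 1
  · simp
  · exact Finset.sum_congr rfl fun j hj => by
      rw [Function.update_of_ne (Finset.ne_of_mem_erase hj)]

/-- The contraction principle for the absolute value. -/
theorem sum_iSup_signSum_abs_le {T : Type*} [Nonempty T] (t : T → ι → ℝ) (B : ℝ)
    (hB : ∀ τ i, |t τ i| ≤ B) :
    ∑ ε, ⨆ τ, signSum ε (fun i => |t τ i|) ≤ ∑ ε, ⨆ τ, signSum ε (t τ) := by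
  let w : Finset ι → T → ι → ℝ := fun U τ i => if i ∈ U then |t τ i| else t τ i
  have hbdd : ∀ U ε, BddAbove (Set.range fun τ => signSum ε (w U τ)) := by
    intro U ε
    refine ⟨∑ _i : ι, B, ?_⟩
    rintro _ ⟨τ, rfl⟩
    refine (le_abs_self _).trans ((abs_signSum_le _ _).trans (Finset.sum_le_sum fun i _ => ?_))
    simp only [w]
    split_ifs
    · rw [abs_abs]; exact hB τ i
    · exact hB τ i
  have step : ∀ (U : Finset ι) (i : ι), i ∉ U →
      ∑ ε, ⨆ τ, signSum ε (w (insert i U) τ) ≤ ∑ ε, ⨆ τ, signSum ε (w U τ) := by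
    intro U i hi
    have pt : ∀ ε : ι → Bool, (⨆ τ, signSum (Function.update ε i true) (w (insert i U) τ)) +
        (⨆ τ, signSum (Function.update ε i false) (w (insert i U) τ)) ≤
        (⨆ τ, signSum (Function.update ε i true) (w U τ)) +
        (⨆ τ, signSum (Function.update ε i false) (w U τ)) := by
      intro ε
      refine ciSup_add_ciSup_le fun τ σ => ?_
      have hrest : ∀ τ, ∑ j ∈ Finset.univ.erase i, boolSign (ε j) * w (insert i U) τ j =
          ∑ j ∈ Finset.univ.erase i, boolSign (ε j) * w U τ j := fun τ =>
        Finset.sum_congr rfl fun j hj => by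
          simp [w, Finset.ne_of_mem_erase hj]
      have e1 : ∀ τ, w (insert i U) τ i = |t τ i| := fun τ => by simp [w]
      have e2 : ∀ τ, w U τ i = t τ i := fun τ => by simp [w, hi]
      have u1 := fun b τ => le_ciSup (hbdd U (Function.update ε i b)) τ
      simp only [signSum_update, hrest, e1, e2, boolSign_true, boolSign_false] at u1 ⊢
      have a1 := u1 true τ
      have a2 := u1 false σ
      have a3 := u1 true σ
      have a4 := u1 false τ
      simp only [boolSign_true, boolSign_false] at a1 a2 a3 a4
      have := abs_sub_abs_le_abs_sub (t τ i) (t σ i)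
      rcases abs_cases (t τ i - t σ i) with ⟨h, -⟩ | ⟨h, -⟩ <;> linarith
    have dbl : ∀ F : (ι → Bool) → ℝ, ∑ ε, (F (Function.update ε i true) +
        F (Function.update ε i false)) = 2 * ∑ ε, F ε := by
      intro F
      rw [two_mul]
      nth_rw 2 [← sum_update_not i F]
      rw [← Finset.sum_add_distrib]
      refine Finset.sum_congr rfl fun ε _ => ?_
      have h0 := Function.update_eq_self i ε
      cases h : ε i
      · rw [h] at h0; simp only [h0, Bool.not_false]; ring
      · rw [h] at h0; simp only [h0, Bool.not_true]
    have := Finset.sum_le_sum fun ε (_ : ε ∈ Finset.univ) => pt ε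
    rw [dbl fun ε => ⨆ τ, signSum ε (w (insert i U) τ), dbl fun ε => ⨆ τ, signSum ε (w U τ)] at this
    linarith
  have all : ∀ U : Finset ι,
      ∑ ε, ⨆ τ, signSum ε (w U τ) ≤ ∑ ε, ⨆ τ, signSum ε (w ∅ τ) := by
    intro U
    induction U using Finset.induction_on with
    | empty => exact le_rfl
    | insert i U hi ih => exact (step U i hi).trans ih
  have := all Finset.univ
  simpa [w] using this

end Signs

/-- Averaging the real parts of the rotations of a complex number. -/
theorem integral_abs_re_rotate (z : ℂ) :
    ∫ θ in (0 : ℝ)..2 * Real.pi, |(Complex.exp (θ * Complex.I) * z).re| =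
      ‖z‖ * ∫ θ in (0 : ℝ)..2 * Real.pi, |Real.cos θ| := by
  have h : ∀ θ : ℝ, |(Complex.exp (θ * Complex.I) * z).re| = ‖z‖ * |Real.cos (θ + z.arg)| := by
    intro θ
    conv_lhs => rw [← Complex.norm_mul_exp_arg_mul_I z]
    rw [mul_left_comm, ← Complex.exp_add, ← add_mul, ← Complex.ofReal_add, Complex.re_ofReal_mul,
      Complex.exp_ofReal_mul_I_re, abs_mul, abs_norm]
  simp only [h, intervalIntegral.integral_const_mul]
  rw [intervalIntegral.integral_comp_add_right (fun θ => |Real.cos θ|)]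
  have hp : Function.Periodic (fun θ => |Real.cos θ|) (2 * Real.pi) := fun θ => by simp
  have := hp.intervalIntegral_add_eq z.arg 0
  rw [zero_add] at this ⊢
  rw [add_comm (2 * Real.pi), this]

theorem pi_le_integral_abs_cos :
    Real.pi ≤ ∫ θ in (0 : ℝ)..2 * Real.pi, |Real.cos θ| := by
  have h : ∫ θ in (0 : ℝ)..2 * Real.pi, Real.cos θ ^ 2 = Real.pi := by
    rw [integral_cos_sq]; simp
  calc Real.pi = ∫ θ in (0 : ℝ)..2 * Real.pi, Real.cos θ ^ 2 := h.symm
    _ ≤ _ := by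
      refine intervalIntegral.integral_mono_on Real.two_pi_pos.le ?_ ?_ fun θ _ => ?_
      · exact Continuous.intervalIntegrable (by fun_prop) _ _
      · exact Continuous.intervalIntegrable (by fun_prop) _ _
      · rw [← sq_abs]
        have := Real.abs_cos_le_one θ
        nlinarith [abs_nonneg (Real.cos θ)]

/-- A signed sum of moduli is controlled by signed sums of the moduli of real parts of
rotations. -/
theorem abs_signSum_norm_le {ι : Type*} [Fintype ι] (ε : ι → Bool) (f : ι → ℂ) (B : ℝ)
    (h : ∀ θ : ℝ, |signSum ε (fun i => |(Complex.exp (θ * Complex.I) * f i).re|)| ≤ B) :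
    |signSum ε (fun i => ‖f i‖)| ≤ 2 * B := by
  set c := ∫ θ in (0 : ℝ)..2 * Real.pi, |Real.cos θ| with hc
  have hpi := pi_le_integral_abs_cos
  have e : ∫ θ in (0 : ℝ)..2 * Real.pi,
      signSum ε (fun i => |(Complex.exp (θ * Complex.I) * f i).re|) =
      c * signSum ε (fun i => ‖f i‖) := by
    simp only [signSum]
    rw [intervalIntegral.integral_finsetSum]
    · rw [Finset.mul_sum]
      refine Finset.sum_congr rfl fun i _ => ?_
      rw [intervalIntegral.integral_const_mul, integral_abs_re_rotate, ← hc]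
      ring
    · exact fun i _ => Continuous.intervalIntegrable (by fun_prop) _ _
  have b := intervalIntegral.norm_integral_le_of_norm_le_const
    (a := 0) (b := 2 * Real.pi) (C := B)
    (f := fun θ : ℝ => signSum ε (fun i => |(Complex.exp (θ * Complex.I) * f i).re|))
    (fun θ _ => h θ)
  rw [e, Real.norm_eq_abs, abs_mul, sub_zero, abs_of_pos Real.two_pi_pos,
    abs_of_nonneg (Real.pi_pos.le.trans hpi)] at b
  have : Real.pi * |signSum ε (fun i => ‖f i‖)| ≤ Real.pi * (2 * B) := by
    nlinarith [mul_le_mul_of_nonneg_right hpi (abs_nonneg (signSum ε (fun i => ‖f i‖)))]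
  exact le_of_mul_le_mul_left this Real.pi_pos

section Abstract

variable {G : Type*} [Fintype G]

/-- The normalized `ℓ₁` norm on a finite set. -/
noncomputable def gridNorm (f : G → ℂ) : ℝ := (∑ y, ‖f y‖) / Fintype.card G

theorem gridNorm_nonneg (f : G → ℂ) : 0 ≤ gridNorm f := by unfold gridNorm; positivity

/-- The functions reproduced by the kernel `D` on the finite set `G`. -/
def reproduced (D : G → G → ℂ) : Set (G → ℂ) :=
  {f | ∀ ξ, Fintype.card G * f ξ = ∑ y, f y * D ξ y}

theorem const_mul_mem_reproduced {D : G → G → ℂ} {f : G → ℂ} (hf : f ∈ reproduced D) (c : ℂ) :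
    (fun ξ => c * f ξ) ∈ reproduced D := by
  intro ξ
  have := hf ξ
  simp only [mul_assoc, ← Finset.mul_sum, ← this]
  ring

theorem gridNorm_const_mul (c : ℂ) (f : G → ℂ) :
    gridNorm (fun ξ => c * f ξ) = ‖c‖ * gridNorm f := by
  simp only [gridNorm, norm_mul, ← Finset.mul_sum, mul_div_assoc]

theorem card_mul_gridNorm [Nonempty G] (f : G → ℂ) : Fintype.card G * gridNorm f = ∑ y, ‖f y‖ := by
  have : (Fintype.card G : ℝ) ≠ 0 := by exact_mod_cast Fintype.card_ne_zero
  unfold gridNorm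
  field_simp

theorem norm_le_of_mem_reproduced [Nonempty G] {D : G → G → ℂ} {N : ℝ} (hD : ∀ ξ y, ‖D ξ y‖ ≤ N)
    {f : G → ℂ} (hf : f ∈ reproduced D) (ξ : G) : ‖f ξ‖ ≤ N * gridNorm f := by
  have hc : (0 : ℝ) < Fintype.card G := by exact_mod_cast Fintype.card_pos
  refine le_of_mul_le_mul_left ?_ hc
  have h := congrArg norm (hf ξ)
  rw [norm_mul, Complex.norm_natCast] at h
  rw [h]
  calc ‖∑ y, f y * D ξ y‖ ≤ ∑ y, ‖f y‖ * N := by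
        refine (norm_sum_le _ _).trans (Finset.sum_le_sum fun y _ => ?_)
        rw [norm_mul]
        exact mul_le_mul_of_nonneg_left (hD ξ y) (norm_nonneg _)
    _ = _ := by rw [← Finset.sum_mul, ← card_mul_gridNorm]; ring

/-- The unit ball of the space of reproduced functions. -/
def reproducedBall (D : G → G → ℂ) : Set (G → ℂ) := {f | f ∈ reproduced D ∧ gridNorm f ≤ 1}

theorem zero_mem_reproducedBall (D : G → G → ℂ) : (fun _ => 0) ∈ reproducedBall D :=
  ⟨fun ξ => by simp, by simp [gridNorm]⟩

variable [DecidableEq G]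

/-- The signed sum over a subset. -/
noncomputable def subSignSum (S : Finset G) (ε : G → Bool) (a : G → ℝ) : ℝ :=
  signSum ε fun ξ => if ξ ∈ S then a ξ else 0

theorem subSignSum_eq (S : Finset G) (ε : G → Bool) (a : G → ℝ) :
    subSignSum S ε a = ∑ ξ ∈ S, boolSign (ε ξ) * a ξ := by
  simp [subSignSum, signSum, mul_ite]

theorem sum_iSup_abs_subSignSum_le [Nonempty G] (S : Finset G) (a : G → G → ℝ) {V : ℝ} (hV : 0 < V)
    (ha : ∀ y, ∑ ξ ∈ S, a y ξ ^ 2 ≤ V) :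
    ∑ ε : G → Bool, ⨆ y, |subSignSum S ε (a y)| ≤
      Fintype.card (G → Bool) * Real.sqrt (2 * V * Real.log (2 * Fintype.card G)) := by
  refine sum_le_of_le_abs_signSum (fun y ξ => if ξ ∈ S then a y ξ else 0) hV (fun y => ?_) _
    fun ε => ?_
  · simpa [ite_pow] using ha y
  · obtain ⟨y, hy⟩ := exists_eq_ciSup_of_finite (f := fun y => |subSignSum S ε (a y)|)
    exact ⟨y, hy.symm.le⟩

theorem le_iSup_abs_subSignSum (S : Finset G) (a : G → G → ℝ) (ε : G → Bool) (y : G) :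
    |subSignSum S ε (a y)| ≤ ⨆ y, |subSignSum S ε (a y)| :=
  le_ciSup (f := fun y => |subSignSum S ε (a y)|) (Set.finite_range _).bddAbove y

variable [Nonempty G]

/-- The supremum over the unit ball of the signed sums of absolute values of real parts. -/
noncomputable def supAbsRe (D : G → G → ℂ) (S : Finset G) (ε : G → Bool) : ℝ :=
  ⨆ f : reproducedBall D, subSignSum S ε fun ξ => |(f.1 ξ).re|

theorem subSignSum_re_le (D : G → G → ℂ) (S : Finset G) (ε : G → Bool) {f : G → ℂ}
    (hf : f ∈ reproducedBall D) :
    subSignSum S ε (fun ξ => (f ξ).re) ≤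
      (⨆ y, |subSignSum S ε (fun ξ => (D ξ y).re)|) +
        ⨆ y, |subSignSum S ε (fun ξ => (D ξ y).im)| := by
  have hc : (0 : ℝ) < Fintype.card G := by exact_mod_cast Fintype.card_pos
  set A := ⨆ y, |subSignSum S ε (fun ξ => (D ξ y).re)| with hA
  set B := ⨆ y, |subSignSum S ε (fun ξ => (D ξ y).im)| with hB
  have hnorm : ∀ y, ‖∑ ξ ∈ S, (boolSign (ε ξ) : ℂ) * D ξ y‖ ≤ A + B := by
    intro y
    refine (Complex.norm_le_abs_re_add_abs_im _).trans ?_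
    have h1 := le_iSup_abs_subSignSum S (fun y ξ => (D ξ y).re) ε y
    have h2 := le_iSup_abs_subSignSum S (fun y ξ => (D ξ y).im) ε y
    rw [subSignSum_eq] at h1 h2
    simpa using add_le_add h1 h2
  have hAB : 0 ≤ A + B := (norm_nonneg _).trans (hnorm (Classical.arbitrary G))
  have e : (Fintype.card G : ℂ) * ∑ ξ ∈ S, (boolSign (ε ξ) : ℂ) * f ξ =
      ∑ y, f y * ∑ ξ ∈ S, (boolSign (ε ξ) : ℂ) * D ξ y := by
    simp only [Finset.mul_sum]
    rw [Finset.sum_comm]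
    refine Finset.sum_congr rfl fun ξ _ => ?_
    rw [mul_left_comm, hf.1 ξ, Finset.mul_sum]
    exact Finset.sum_congr rfl fun y _ => by ring
  have e2 : subSignSum S ε (fun ξ => (f ξ).re) = (∑ ξ ∈ S, (boolSign (ε ξ) : ℂ) * f ξ).re := by
    rw [subSignSum_eq]; simp
  rw [e2]
  refine (Complex.re_le_norm _).trans (le_of_mul_le_mul_left ?_ hc)
  have h := congrArg norm e
  rw [norm_mul, Complex.norm_natCast] at h
  rw [h]
  calc _ ≤ ∑ y, ‖f y‖ * (A + B) := by
        refine (norm_sum_le _ _).trans (Finset.sum_le_sum fun y _ => ?_)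
        rw [norm_mul]
        exact mul_le_mul_of_nonneg_left (hnorm y) (norm_nonneg _)
    _ = Fintype.card G * (gridNorm f * (A + B)) := by
        rw [← Finset.sum_mul, ← card_mul_gridNorm]; ring
    _ ≤ _ := by
        gcongr
        exact mul_le_of_le_one_left hAB hf.2

variable {D : G → G → ℂ} {N : ℝ}

theorem sum_supAbsRe_le (hN : 1 ≤ N) (hD : ∀ ξ y, ‖D ξ y‖ ≤ N) (S : Finset G) :
    ∑ ε, supAbsRe D S ε ≤ ∑ ε : G → Bool, ((⨆ y, |subSignSum S ε (fun ξ => (D ξ y).re)|) +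
        ⨆ y, |subSignSum S ε (fun ξ => (D ξ y).im)|) := by
  have : Nonempty (reproducedBall D) := ⟨⟨_, zero_mem_reproducedBall D⟩⟩
  have h := sum_iSup_signSum_abs_le (ι := G) (T := reproducedBall D)
    (fun f ξ => if ξ ∈ S then (f.1 ξ).re else 0) N (fun f ξ => by
      have h1 : ‖f.1 ξ‖ ≤ N := (norm_le_of_mem_reproduced hD f.2.1 ξ).trans
        (mul_le_of_le_one_right (by linarith) f.2.2)
      split_ifs
      · exact (Complex.abs_re_le_norm _).trans h1
      · rw [abs_zero]; linarith)
  have e : ∀ (f : reproducedBall D) ξ, |if ξ ∈ S then (f.1 ξ).re else 0| =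
      if ξ ∈ S then |(f.1 ξ).re| else 0 := fun f ξ => by split_ifs <;> simp
  simp only [e] at h
  refine h.trans (Finset.sum_le_sum fun ε _ => ciSup_le fun f => ?_)
  exact subSignSum_re_le D S ε f.2

theorem subSignSum_le_supAbsRe (hN : 1 ≤ N) (hD : ∀ ξ y, ‖D ξ y‖ ≤ N) (S : Finset G)
    (ε : G → Bool) {f : G → ℂ} (hf : f ∈ reproducedBall D) :
    subSignSum S ε (fun ξ => |(f ξ).re|) ≤ supAbsRe D S ε := by
  refine le_ciSup (f := fun f : reproducedBall D => subSignSum S ε fun ξ => |(f.1 ξ).re|) ?_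
    (⟨f, hf⟩ : reproducedBall D)
  refine ⟨∑ _ξ : G, N, ?_⟩
  rintro _ ⟨g, rfl⟩
  refine (le_abs_self _).trans ((abs_signSum_le _ _).trans (Finset.sum_le_sum fun ξ _ => ?_))
  have h1 : ‖g.1 ξ‖ ≤ N := (norm_le_of_mem_reproduced hD g.2.1 ξ).trans
    (mul_le_of_le_one_right (by linarith) g.2.2)
  split_ifs
  · rw [abs_abs]; exact (Complex.abs_re_le_norm _).trans h1
  · rw [abs_zero]; linarith

theorem supAbsRe_nonneg (hN : 1 ≤ N) (hD : ∀ ξ y, ‖D ξ y‖ ≤ N) (S : Finset G)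
    (ε : G → Bool) : 0 ≤ supAbsRe D S ε := by
  have := subSignSum_le_supAbsRe hN hD S ε (zero_mem_reproducedBall D)
  simpa [subSignSum_eq] using this

theorem abs_subSignSum_norm_le (hN : 1 ≤ N) (hD : ∀ ξ y, ‖D ξ y‖ ≤ N) (S : Finset G)
    (ε : G → Bool) {f : G → ℂ} (hf : f ∈ reproduced D) :
    |subSignSum S ε (fun ξ => ‖f ξ‖)| ≤
      2 * (supAbsRe D S ε + supAbsRe D S (fun ξ => !ε ξ)) * gridNorm f := by
  have unit : ∀ g ∈ reproducedBall D, |subSignSum S ε (fun ξ => ‖g ξ‖)| ≤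
      2 * (supAbsRe D S ε + supAbsRe D S (fun ξ => !ε ξ)) := by
    intro g hg
    have e : subSignSum S ε (fun ξ => ‖g ξ‖) =
        signSum ε (fun ξ => ‖if ξ ∈ S then g ξ else 0‖) := by
      unfold subSignSum
      congr 1; ext ξ; split_ifs <;> simp
    rw [e]
    refine abs_signSum_norm_le ε _ _ fun θ => ?_
    have hg' : (fun ξ => Complex.exp (θ * Complex.I) * g ξ) ∈ reproducedBall D :=
      ⟨const_mul_mem_reproduced hg.1 _, by
        rw [gridNorm_const_mul, Complex.norm_exp_ofReal_mul_I, one_mul]; exact hg.2⟩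
    have e' : signSum ε (fun ξ =>
        |(Complex.exp (θ * Complex.I) * if ξ ∈ S then g ξ else 0).re|) =
        subSignSum S ε (fun ξ => |(Complex.exp (θ * Complex.I) * g ξ).re|) := by
      unfold subSignSum
      congr 1; ext ξ; split_ifs <;> simp
    rw [e']
    have h1 := subSignSum_le_supAbsRe hN hD S ε hg'
    have h2 := subSignSum_le_supAbsRe hN hD S (fun ξ => !ε ξ) hg'
    have h3 := supAbsRe_nonneg hN hD S ε
    have h4 := supAbsRe_nonneg hN hD S (fun ξ => !ε ξ)
    have h5 : subSignSum S (fun ξ => !ε ξ)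
        (fun ξ => |(Complex.exp (θ * Complex.I) * g ξ).re|) =
        -subSignSum S ε (fun ξ => |(Complex.exp (θ * Complex.I) * g ξ).re|) := signSum_not _ _
    rw [h5] at h2
    exact abs_le.2 ⟨by linarith, by linarith⟩
  rcases (gridNorm_nonneg f).eq_or_lt with h0 | h0
  · have hz : ∀ ξ, ‖f ξ‖ = 0 := fun ξ => le_antisymm
      ((norm_le_of_mem_reproduced hD hf ξ).trans (by rw [← h0, mul_zero])) (norm_nonneg _)
    simp [hz, ← h0, subSignSum_eq]
  · have hu := unit (fun ξ => ((gridNorm f)⁻¹ : ℂ) * f ξ) ⟨const_mul_mem_reproduced hf _, by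
      rw [gridNorm_const_mul, norm_inv, Complex.norm_real, Real.norm_of_nonneg h0.le,
        inv_mul_cancel₀ h0.ne']⟩
    simp only [norm_mul, norm_inv, Complex.norm_real, Real.norm_of_nonneg h0.le] at hu
    have e : subSignSum S ε (fun ξ => (gridNorm f)⁻¹ * ‖f ξ‖) =
        (gridNorm f)⁻¹ * subSignSum S ε (fun ξ => ‖f ξ‖) := by
      simp only [subSignSum_eq, Finset.mul_sum]
      exact Finset.sum_congr rfl fun i _ => by ring
    rw [e, abs_mul, abs_of_pos (inv_pos.2 h0), inv_mul_le_iff₀ h0] at hu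
    linarith

/-- Signs that nearly balance the cardinality, the square function of the kernel and all the
`ℓ₁` sums of reproduced functions at once. -/
theorem exists_balancing_signs (hN : 1 ≤ N) (hD : ∀ ξ y, ‖D ξ y‖ ≤ N) {S : Finset G}
    (hS : S.Nonempty) (hS2 : ∀ y, ∑ ξ ∈ S, ‖D ξ y‖ ^ 2 ≤ 2 * S.card * N) :
    ∃ ε : G → Bool, ∀ r, r = 20 * Real.sqrt (S.card * N * Real.log (2 * Fintype.card G)) →
      |∑ ξ ∈ S, boolSign (ε ξ)| ≤ r ∧
      (∀ y, |∑ ξ ∈ S, boolSign (ε ξ) * ‖D ξ y‖ ^ 2| ≤ r * N) ∧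
      ∀ f ∈ reproduced D, |∑ ξ ∈ S, boolSign (ε ξ) * ‖f ξ‖| ≤ r * gridNorm f := by
  have hN0 : 0 < N := by linarith
  have hs : (0 : ℝ) < S.card := by exact_mod_cast hS.card_pos
  set L := Real.log (2 * Fintype.card G) with hL
  set R := Real.sqrt (2 * (2 * S.card * N) * L) with hR
  have hV : 0 < 2 * S.card * N := by positivity
  have hRr : 10 * R = 20 * Real.sqrt (S.card * N * L) := by
    have : 2 * (2 * S.card * N) * L = 2 ^ 2 * (S.card * N * L) := by ring
    rw [hR, this, Real.sqrt_mul (by norm_num), Real.sqrt_sq (by norm_num)]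
    ring
  have b1 := sum_iSup_abs_subSignSum_le S (fun _ _ => 1) hV (fun y => by
    simp only [one_pow, Finset.sum_const, nsmul_eq_mul, mul_one]; nlinarith)
  have b2 := sum_iSup_abs_subSignSum_le S (fun y ξ => ‖D ξ y‖ ^ 2 / N) hV (fun y => by
    refine le_trans (Finset.sum_le_sum fun ξ _ => ?_) (hS2 y)
    rw [div_pow, div_le_iff₀ (by positivity)]
    have := pow_le_pow_left₀ (norm_nonneg _) (hD ξ y) 2
    nlinarith [sq_nonneg ‖D ξ y‖])
  have b3 := sum_iSup_abs_subSignSum_le S (fun y ξ => (D ξ y).re) hV (fun y => by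
    refine le_trans (Finset.sum_le_sum fun ξ _ => ?_) (hS2 y)
    rw [← sq_abs]
    exact pow_le_pow_left₀ (abs_nonneg _) (Complex.abs_re_le_norm _) 2)
  have b4 := sum_iSup_abs_subSignSum_le S (fun y ξ => (D ξ y).im) hV (fun y => by
    refine le_trans (Finset.sum_le_sum fun ξ _ => ?_) (hS2 y)
    rw [← sq_abs]
    exact pow_le_pow_left₀ (abs_nonneg _) (Complex.abs_im_le_norm _) 2)
  rw [← hL, ← hR] at b1 b2 b3 b4
  have b5 := sum_supAbsRe_le hN hD S
  rw [Finset.sum_add_distrib] at b5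
  have b6 : ∑ ε : G → Bool, supAbsRe D S (fun ξ => !ε ξ) = ∑ ε, supAbsRe D S ε := by
    have hinv : Function.Involutive fun (ε : G → Bool) ξ => !ε ξ := fun ε => by simp
    exact Equiv.sum_comp (Function.Involutive.toPerm _ hinv) (supAbsRe D S)
  obtain ⟨ε, -, hε⟩ := Finset.exists_le_of_sum_le (s := (Finset.univ : Finset (G → Bool)))
    (f := fun ε => (⨆ y : G, |subSignSum S ε ((fun _ _ => 1 : G → G → ℝ) y)|) +
      (⨆ y, |subSignSum S ε (fun ξ => ‖D ξ y‖ ^ 2 / N)|) +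
      2 * (supAbsRe D S ε + supAbsRe D S (fun ξ => !ε ξ)))
    (g := fun _ => 10 * R) Finset.univ_nonempty (by
      simp only [Finset.sum_add_distrib, ← Finset.mul_sum, Finset.sum_const, Finset.card_univ,
        nsmul_eq_mul, b6]
      linarith)
  have p1 := le_iSup_abs_subSignSum S (fun _ _ => 1) ε (Classical.arbitrary G)
  have p2 := le_iSup_abs_subSignSum S (fun y ξ => ‖D ξ y‖ ^ 2 / N) ε
  have q1 := (abs_nonneg _).trans p1
  have q2 := (abs_nonneg _).trans (p2 (Classical.arbitrary G))
  have q3 := supAbsRe_nonneg hN hD S ε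
  have q4 := supAbsRe_nonneg hN hD S (fun ξ => !ε ξ)
  refine ⟨ε, fun r hr => ?_⟩
  rw [← hRr] at hr
  subst hr
  refine ⟨?_, fun y => ?_, fun f hf => ?_⟩
  · have h : |subSignSum S ε (fun _ => 1)| ≤ 10 * R := by linarith
    simpa only [subSignSum_eq, mul_one] using h
  · have h := p2 y
    have e : subSignSum S ε (fun ξ => ‖D ξ y‖ ^ 2 / N) =
        (∑ ξ ∈ S, boolSign (ε ξ) * ‖D ξ y‖ ^ 2) / N := by
      rw [subSignSum_eq, Finset.sum_div]
      exact Finset.sum_congr rfl fun i _ => by ring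
    rw [← div_le_iff₀ hN0]
    rw [e, abs_div, abs_of_pos hN0] at h
    linarith
  · rw [← subSignSum_eq]
    refine (abs_subSignSum_norm_le hN hD S ε hf).trans ?_
    exact mul_le_mul_of_nonneg_right (by linarith) (gridNorm_nonneg f)

/-- `S` discretizes the `ℓ₁` norm of the reproduced functions and the square function of the kernel
with relative error `η`. -/
structure Discretizes (D : G → G → ℂ) (N : ℝ) (S : Finset G) (η : ℝ) : Prop where
  norm_le : ∀ f ∈ reproduced D,
    |∑ ξ ∈ S, ‖f ξ‖ - S.card * gridNorm f| ≤ η * (S.card * gridNorm f)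
  sq_le : ∀ y, ∑ ξ ∈ S, ‖D ξ y‖ ^ 2 ≤ (1 + η) * (S.card * N)

/-- One halving step. -/
theorem Discretizes.exists_half (hN : 1 ≤ N) (hD : ∀ ξ y, ‖D ξ y‖ ≤ N) {S : Finset G} {q : ℝ}
    (hS : S.Nonempty) (hq : q = Real.sqrt (Real.log (2 * Fintype.card G) * N / S.card))
    (hq' : q ≤ 1 / 2400) (h : Discretizes D N S (300 * q)) :
    ∃ S' : Finset G, (S.card : ℝ) ≤ 4 * S'.card ∧ (S'.card : ℝ) ≤ S.card / 2 ∧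
      Discretizes D N S'
        (300 * Real.sqrt (Real.log (2 * Fintype.card G) * N / S'.card)) := by
  have hN0 : 0 < N := by linarith
  have hs : (0 : ℝ) < S.card := by exact_mod_cast hS.card_pos
  have hG : (1 : ℝ) ≤ Fintype.card G := by exact_mod_cast Fintype.card_pos (α := G)
  set L := Real.log (2 * Fintype.card G) with hL
  have hL0 : 0 < L := Real.log_pos (by linarith)
  set s : ℝ := (S.card : ℝ) with hsdef
  have hq0 : 0 ≤ q := hq ▸ Real.sqrt_nonneg _
  have hq2 : q ^ 2 = L * N / s := by rw [hq]; exact Real.sq_sqrt (by positivity)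
  obtain ⟨ε, hε⟩ := exists_balancing_signs hN hD hS (fun y => (h.sq_le y).trans (by
    have : 0 < s * N := by positivity
    nlinarith))
  obtain ⟨h1, h2, h3⟩ := hε (20 * q * s) (by
    rw [mul_assoc, ← hsdef, ← hL, show s * N * L = (q * s) ^ 2 by rw [mul_pow, hq2]; field_simp,
      Real.sqrt_sq (by positivity)])
  obtain ⟨b, hb⟩ : ∃ b, boolSign b * ∑ ξ ∈ S, boolSign (ε ξ) ≤ 0 := by
    rcases le_total (∑ ξ ∈ S, boolSign (ε ξ)) 0 with h0 | h0
    · exact ⟨true, by simpa using h0⟩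
    · exact ⟨false, by simpa using h0⟩
  set S' := S.filter fun ξ => ε ξ = b with hS'
  have hsum : ∀ a : G → ℝ,
      ∑ ξ ∈ S', a ξ = (∑ ξ ∈ S, a ξ + boolSign b * ∑ ξ ∈ S, boolSign (ε ξ) * a ξ) / 2 := by
    intro a
    rw [hS', Finset.sum_filter, Finset.mul_sum, ← Finset.sum_add_distrib, Finset.sum_div]
    refine Finset.sum_congr rfl fun ξ _ => ?_
    cases b <;> cases ε ξ <;> simp
  have hbabs : ∀ x, |boolSign b * x| = |x| := fun x => by rw [abs_mul, abs_boolSign, one_mul]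
  have hcard := hsum fun _ => 1
  simp only [Finset.sum_const, nsmul_eq_mul, mul_one, ← hsdef] at hcard
  set s' : ℝ := (S'.card : ℝ) with hs'def
  rw [← hbabs] at h1
  have h1' := (abs_le.1 h1).1
  set e := boolSign b * ∑ ξ ∈ S, boolSign (ε ξ) with he
  have hqs : q * s ≤ 1 / 2400 * s := mul_le_mul_of_nonneg_right hq' hs.le
  have hs's : s ≤ 4 * s' := by linarith
  have hs'2 : s' ≤ s / 2 := by linarith
  have hs'0 : 0 < s' := by linarith
  have hs'q : s * (1 - 20 * q) / 2 ≤ s' := by linarith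
  refine ⟨S', hs's, hs'2, ?_⟩
  set q' := Real.sqrt (L * N / s') with hq'def
  have hqq : 1.4 * q ≤ q' := by
    refine Real.le_sqrt_of_sq_le ?_
    rw [mul_pow, hq2, le_div_iff₀ hs'0, ← mul_div_assoc, div_mul_eq_mul_div, div_le_iff₀ hs]
    have : 0 < L * N := by positivity
    nlinarith
  have hq'0 : 0 ≤ q' := Real.sqrt_nonneg _
  have hkey : 340 * (q * s) ≤ 600 * q' * s' := by
    have i1 : 1.4 * q * (s * (1 - 20 * q) / 2) ≤ q' * s' := mul_le_mul hqq hs'q (by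
      have : 0 ≤ 1 - 20 * q := by linarith
      positivity) hq'0
    have i2 : q * (q * s) ≤ 1 / 2400 * (q * s) := mul_le_mul_of_nonneg_right hq' (by positivity)
    have i3 : 0 ≤ q * s := by positivity
    nlinarith
  constructor
  · intro f hf
    have g0 := gridNorm_nonneg f
    have k1 := h.norm_le f hf
    have k2 := h3 f hf
    rw [← hbabs] at k2
    rw [hsum]
    have k3 : |e * gridNorm f| ≤ 20 * q * s * gridNorm f := by
      rw [abs_mul, abs_of_nonneg g0]
      exact mul_le_mul_of_nonneg_right h1 g0
    have k4 := mul_le_mul_of_nonneg_right hkey g0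
    rw [← hsdef] at k1
    rw [← hs'def, hcard]
    rw [hcard] at k4
    rw [abs_le] at k1 k2 k3 ⊢
    constructor <;> linarith
  · intro y
    have k1 := h.sq_le y
    have k2 := h2 y
    rw [← hbabs] at k2
    rw [hsum]
    have k4 := mul_le_mul_of_nonneg_right hkey hN0.le
    have k3 := mul_le_mul_of_nonneg_right h1' hN0.le
    rw [← hsdef] at k1
    rw [← hs'def, hcard]
    rw [hcard] at k4
    rw [abs_le] at k2
    linarith

/-- A finite uniform probability space with a bounded reproducing kernel contains a small subset that
discretizes the `ℓ₁` norm of the reproduced functions. -/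
theorem exists_discretizing_subset (hN : 1 ≤ N) (hD : ∀ ξ y, ‖D ξ y‖ ≤ N)
    (hD2 : ∀ y, ∑ ξ, ‖D ξ y‖ ^ 2 ≤ Fintype.card G * N) :
    ∃ S : Finset G, S.Nonempty ∧
      (S.card : ℝ) ≤ 4 * (2400 ^ 2 * Real.log (2 * Fintype.card G) * N) ∧
      ∀ f ∈ reproduced D,
        |∑ ξ ∈ S, ‖f ξ‖ - S.card * gridNorm f| ≤ 1 / 8 * (S.card * gridNorm f) := by
  have hN0 : 0 < N := by linarith
  have hG : (1 : ℝ) ≤ Fintype.card G := by exact_mod_cast Fintype.card_pos (α := G)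
  set L := Real.log (2 * Fintype.card G) with hL
  have hL0 : 0 < L := Real.log_pos (by linarith)
  set t := 2400 ^ 2 * L * N with ht
  have ht0 : 0 < t := by positivity
  have huniv : ∀ η : ℝ, 0 ≤ η → Discretizes D N (Finset.univ : Finset G) η := by
    refine fun η hη => ⟨fun f _ => ?_, fun y => ?_⟩
    · rw [Finset.card_univ, card_mul_gridNorm, sub_self, abs_zero]
      positivity
    · refine (hD2 y).trans ?_
      rw [Finset.card_univ]
      exact le_mul_of_one_le_left (by positivity) (by linarith)
  have hqle : ∀ s : ℝ, 0 < s → t ≤ s → Real.sqrt (L * N / s) ≤ 1 / 2400 := by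
    intro s hs hts
    rw [Real.sqrt_le_left (by norm_num), div_le_iff₀ hs]
    linarith
  have main : ∀ (n : ℕ) (S : Finset G), S.card = n → S.Nonempty → t ≤ S.card →
      Discretizes D N S (300 * Real.sqrt (L * N / S.card)) →
      ∃ S : Finset G, S.Nonempty ∧ (S.card : ℝ) ≤ 4 * t ∧ ∀ f ∈ reproduced D,
        |∑ ξ ∈ S, ‖f ξ‖ - S.card * gridNorm f| ≤ 1 / 8 * (S.card * gridNorm f) := by
    intro n
    induction n using Nat.strong_induction_on with
    | _ n ih =>
      intro S hSn hS hSt hd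
      have hs : (0 : ℝ) < S.card := by exact_mod_cast hS.card_pos
      have hq := hqle S.card hs hSt
      rcases le_or_gt (S.card : ℝ) (4 * t) with hle | hlt
      · refine ⟨S, hS, hle, fun f hf => (hd.norm_le f hf).trans ?_⟩
        refine mul_le_mul_of_nonneg_right (by linarith) ?_
        exact mul_nonneg hs.le (gridNorm_nonneg f)
      · obtain ⟨S', h1, h2, h3⟩ := hd.exists_half hN hD hS rfl hq
        have hs' : (0 : ℝ) < S'.card := by linarith
        refine ih S'.card ?_ S' rfl (Finset.card_pos.1 (by exact_mod_cast hs')) (by linarith) h3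
        rw [← hSn]
        have : (S'.card : ℝ) < S.card := by linarith
        exact_mod_cast this
  rcases le_or_gt (Fintype.card G : ℝ) (4 * t) with hle | hlt
  · exact ⟨Finset.univ, Finset.univ_nonempty, by rwa [Finset.card_univ],
      (huniv (1 / 8) (by norm_num)).norm_le⟩
  · exact main _ Finset.univ rfl Finset.univ_nonempty (by rw [Finset.card_univ]; linarith)
      (huniv _ (by positivity))

end Abstract

section OrthogonalSystem

variable {G κ : Type*} {Q : Finset κ} {e : κ → G → ℂ}

/-- The Dirichlet kernel of a system of functions. -/
noncomputable def dirichletKernel (Q : Finset κ) (e : κ → G → ℂ) (ξ y : G) : ℂ :=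
  ∑ k ∈ Q, e k ξ * starRingEnd ℂ (e k y)

theorem norm_dirichletKernel_le (he : ∀ k y, ‖e k y‖ = 1) (ξ y : G) :
    ‖dirichletKernel Q e ξ y‖ ≤ Q.card := by
  refine (norm_sum_le _ _).trans_eq ?_
  simp [he]

variable [Fintype G] [DecidableEq κ]

theorem sum_mul_conj_eq_card_mul_coeff
    (horth : ∀ k ∈ Q, ∀ l ∈ Q,
      ∑ y, e k y * starRingEnd ℂ (e l y) = if k = l then (Fintype.card G : ℂ) else 0)
    (c : κ → ℂ) {k : κ} (hk : k ∈ Q) :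
    ∑ y, (∑ l ∈ Q, c l * e l y) * starRingEnd ℂ (e k y) = Fintype.card G * c k := by
  simp only [Finset.sum_mul]
  rw [Finset.sum_comm]
  simp only [mul_assoc, ← Finset.mul_sum]
  rw [Finset.sum_congr rfl fun l hl => by rw [horth l hl k hk]]
  simp [hk, mul_comm]

theorem norm_coeff_le_gridNorm [Nonempty G] (he : ∀ k y, ‖e k y‖ = 1)
    (horth : ∀ k ∈ Q, ∀ l ∈ Q,
      ∑ y, e k y * starRingEnd ℂ (e l y) = if k = l then (Fintype.card G : ℂ) else 0)
    (c : κ → ℂ) {k : κ} (hk : k ∈ Q) :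
    ‖c k‖ ≤ gridNorm (fun y => ∑ l ∈ Q, c l * e l y) := by
  have hc : (0 : ℝ) < Fintype.card G := by exact_mod_cast Fintype.card_pos
  have h := congrArg norm (sum_mul_conj_eq_card_mul_coeff horth c hk)
  rw [norm_mul, Complex.norm_natCast] at h
  refine le_of_mul_le_mul_left ?_ hc
  rw [← h, card_mul_gridNorm]
  refine (norm_sum_le _ _).trans_eq (Finset.sum_congr rfl fun y _ => ?_)
  rw [norm_mul, RCLike.norm_conj, he, mul_one]

theorem sum_mem_reproduced
    (horth : ∀ k ∈ Q, ∀ l ∈ Q,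
      ∑ y, e k y * starRingEnd ℂ (e l y) = if k = l then (Fintype.card G : ℂ) else 0)
    (c : κ → ℂ) :
    (fun y => ∑ l ∈ Q, c l * e l y) ∈ reproduced (dirichletKernel Q e) := by
  intro ξ
  calc _ = ∑ k ∈ Q, ∑ y, (∑ l ∈ Q, c l * e l y) * (e k ξ * starRingEnd ℂ (e k y)) := by
        rw [Finset.mul_sum]
        refine Finset.sum_congr rfl fun k hk => ?_
        rw [← mul_assoc, ← sum_mul_conj_eq_card_mul_coeff horth c hk, Finset.sum_mul]
        exact Finset.sum_congr rfl fun y _ => by ring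
    _ = _ := by
        rw [Finset.sum_comm]
        exact Finset.sum_congr rfl fun y _ => (Finset.mul_sum _ _ _).symm

theorem sum_norm_dirichletKernel_sq (he : ∀ k y, ‖e k y‖ = 1)
    (horth : ∀ k ∈ Q, ∀ l ∈ Q,
      ∑ y, e k y * starRingEnd ℂ (e l y) = if k = l then (Fintype.card G : ℂ) else 0)
    (y : G) :
    ∑ ξ, ‖dirichletKernel Q e ξ y‖ ^ 2 = Fintype.card G * Q.card := by
  have h : ∀ ξ, ((‖dirichletKernel Q e ξ y‖ ^ 2 : ℝ) : ℂ) = ∑ k ∈ Q,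
      e k y * ((∑ l ∈ Q, starRingEnd ℂ (e l y) * e l ξ) * starRingEnd ℂ (e k ξ)) := by
    intro ξ
    rw [Complex.ofReal_pow, ← Complex.mul_conj']
    simp only [dirichletKernel, map_sum, map_mul, Complex.conj_conj]
    rw [Finset.mul_sum]
    refine Finset.sum_congr rfl fun k _ => ?_
    simp only [mul_comm (e _ ξ)]
    ring
  have : ((∑ ξ, ‖dirichletKernel Q e ξ y‖ ^ 2 : ℝ) : ℂ) = Fintype.card G * Q.card := by
    rw [Complex.ofReal_sum]
    simp only [h]
    rw [Finset.sum_comm]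
    simp only [← Finset.mul_sum]
    rw [Finset.sum_congr rfl fun k hk => by
      rw [sum_mul_conj_eq_card_mul_coeff horth (fun l => starRingEnd ℂ (e l y)) hk,
        mul_left_comm, Complex.mul_conj', he, Complex.ofReal_one, one_pow, mul_one]]
    simp [mul_comm]
  exact_mod_cast this

end OrthogonalSystem

section Grid

variable {d : ℕ}

theorem character_add (k : Fin d → ℤ) (x y : Torus d) :
    character k (x + y) = character k x * character k y := by
  rw [character, character, character, ← Finset.prod_mul_distrib]
  refine Finset.prod_congr rfl fun j _ => ?_
  simp only [fourier_apply, Pi.add_apply, zsmul_add, AddCircle.toCircle_add, Circle.coe_mul]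

theorem character_zero (k : Fin d → ℤ) : character k (0 : Torus d) = 1 := by
  simp [character]

theorem norm_character (k : Fin d → ℤ) (x : Torus d) : ‖character k x‖ = 1 := by
  rw [character, norm_prod]
  exact Finset.prod_eq_one fun j _ => Circle.norm_coe _

theorem continuous_character (k : Fin d → ℤ) : Continuous (character k : Torus d → ℂ) := by
  unfold character
  fun_prop

theorem character_mul_conj (k l : Fin d → ℤ) (x : Torus d) :
    character k x * starRingEnd ℂ (character l x) = character (k - l) x := by
  simp only [character, map_prod, ← Finset.prod_mul_distrib]
  refine Finset.prod_congr rfl fun j _ => ?_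
  rw [← fourier_neg, ← fourier_add, Pi.sub_apply, sub_eq_add_neg]

theorem norm_character_coe_sub_one_le (k : Fin d → ℤ) (τ : Fin d → ℝ) :
    ‖character k (fun j => ((τ j : ℝ) : AddCircle (2 * Real.pi))) - 1‖ ≤
      ∑ j, |(k j : ℝ)| * |τ j| := by
  rw [character_coe]
  have : (∑ j, (k j : ℂ) * (τ j : ℂ)) = ((∑ j, (k j : ℝ) * τ j : ℝ) : ℂ) := by push_cast; rfl
  rw [this]
  refine Real.norm_exp_I_mul_ofReal_sub_one_le.trans ?_
  rw [Real.norm_eq_abs]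
  refine (Finset.abs_sum_le_sum_abs _ _).trans_eq ?_
  simp only [abs_mul]

variable (K : ℕ) [NeZero K]

/-- The embedding of `ℤ/K` into the circle as the group of `K`-torsion points. -/
noncomputable def circleGrid : ZMod K →+ AddCircle (2 * Real.pi) :=
  ZMod.lift K ⟨zmultiplesHom _ ((2 * Real.pi / K : ℝ) : AddCircle (2 * Real.pi)), by
    have h := AddCircle.addOrderOf_period_div (p := 2 * Real.pi) (NeZero.pos K)
    have h2 := addOrderOf_nsmul_eq_zero ((2 * Real.pi / K : ℝ) : AddCircle (2 * Real.pi))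
    rw [h] at h2
    simpa using h2⟩

theorem circleGrid_intCast (m : ℤ) :
    circleGrid K m = m • ((2 * Real.pi / K : ℝ) : AddCircle (2 * Real.pi)) := by
  rw [circleGrid, ZMod.lift_coe]
  rfl

theorem zsmul_period_div_eq_zero_iff (m : ℤ) :
    m • ((2 * Real.pi / K : ℝ) : AddCircle (2 * Real.pi)) = 0 ↔ (K : ℤ) ∣ m := by
  rw [← addOrderOf_dvd_iff_zsmul_eq_zero, AddCircle.addOrderOf_period_div (NeZero.pos K)]

theorem circleGrid_injective : Function.Injective (circleGrid K) := by
  rw [injective_iff_map_eq_zero]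
  intro g hg
  obtain ⟨m, rfl⟩ := ZMod.intCast_surjective g
  rw [circleGrid_intCast, zsmul_period_div_eq_zero_iff] at hg
  exact (ZMod.intCast_zmod_eq_zero_iff_dvd m K).2 hg

theorem exists_eq_circleGrid_add (x : AddCircle (2 * Real.pi)) :
    ∃ (g : ZMod K) (τ : ℝ), |τ| ≤ 2 * Real.pi / K ∧ x = circleGrid K g + (τ : ℝ) := by
  obtain ⟨r, rfl⟩ := QuotientAddGroup.mk_surjective x
  have hK : (0 : ℝ) < K := by exact_mod_cast NeZero.pos K
  have hp : 0 < 2 * Real.pi / K := by positivity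
  refine ⟨(⌊r / (2 * Real.pi / K)⌋ : ℤ), r - ⌊r / (2 * Real.pi / K)⌋ * (2 * Real.pi / K), ?_, ?_⟩
  · have h1 := (le_div_iff₀ hp).1 (Int.floor_le (r / (2 * Real.pi / K)))
    have h2 := (div_lt_iff₀ hp).1 (Int.lt_floor_add_one (r / (2 * Real.pi / K)))
    rw [abs_of_nonneg (by linarith)]
    linarith
  · rw [circleGrid_intCast, ← AddCircle.coe_zsmul, ← AddCircle.coe_add, zsmul_eq_mul,
      add_sub_cancel]

/-- The grid of `K`-torsion points of the torus. -/
noncomputable def torusGrid (g : Fin d → ZMod K) : Torus d := fun j => circleGrid K (g j)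

theorem torusGrid_add (g h : Fin d → ZMod K) :
    torusGrid K (g + h) = torusGrid K g + torusGrid K h := by
  ext j; simp [torusGrid]

theorem torusGrid_zero : torusGrid K (0 : Fin d → ZMod K) = 0 := by
  ext j; simp [torusGrid]

theorem torusGrid_injective : Function.Injective (torusGrid K : (Fin d → ZMod K) → Torus d) :=
  fun _ _ h => funext fun j => circleGrid_injective K (congrFun h j)

/-- The restriction of a character to the grid. -/
noncomputable def gridChar (k : Fin d → ℤ) : AddChar (Fin d → ZMod K) ℂ where
  toFun g := character k (torusGrid K g)
  map_zero_eq_one' := by rw [torusGrid_zero, character_zero]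
  map_add_eq_mul' g h := by rw [torusGrid_add, character_add]

theorem gridChar_ne_zero {k : Fin d → ℤ} {j : Fin d} (hj : ¬ (K : ℤ) ∣ k j) :
    gridChar K k ≠ 0 := by
  intro h
  have h1 := DFunLike.congr_fun h (Pi.single j ((1 : ℤ) : ZMod K))
  have h2 : gridChar K k (Pi.single j ((1 : ℤ) : ZMod K)) =
      fourier (k j) ((2 * Real.pi / K : ℝ) : AddCircle (2 * Real.pi)) := by
    change character k (torusGrid K _) = _
    rw [character, Finset.prod_eq_single j]
    · rw [torusGrid, Pi.single_eq_same, circleGrid_intCast, one_zsmul]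
    · intro i _ hi
      rw [torusGrid, Pi.single_eq_of_ne hi, map_zero, fourier_eval_zero]
    · simp
  rw [h2, AddChar.zero_apply, fourier_apply] at h1
  have h3 : (k j • ((2 * Real.pi / K : ℝ) : AddCircle (2 * Real.pi))) = 0 := by
    apply AddCircle.injective_toCircle Real.two_pi_pos.ne'
    rw [AddCircle.toCircle_zero]
    exact Circle.ext (by simpa using h1)
  exact hj ((zsmul_period_div_eq_zero_iff K _).1 h3)

theorem sum_character_mul_conj {M : ℕ} (hK : 2 * M < K) {k l : Fin d → ℤ}
    (hk : k ∈ freqBox (fun _ : Fin d => M)) (hl : l ∈ freqBox (fun _ : Fin d => M)) :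
    ∑ g : Fin d → ZMod K, character k (torusGrid K g) *
      starRingEnd ℂ (character l (torusGrid K g)) =
      if k = l then (Fintype.card (Fin d → ZMod K) : ℂ) else 0 := by
  simp only [character_mul_conj]
  split_ifs with h
  · subst h
    simp [character]
  · obtain ⟨j, hj⟩ := Function.ne_iff.1 h
    refine AddChar.sum_eq_zero_iff_ne_zero.2 (gridChar_ne_zero K (k := k - l) (j := j) ?_)
    intro hdvd
    have h0 := Int.eq_zero_of_abs_lt_dvd hdvd (by
      have h1 : -(M : ℤ) ≤ k j ∧ k j ≤ M := hk j
      have h2 : -(M : ℤ) ≤ l j ∧ l j ≤ M := hl j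
      rw [Pi.sub_apply, abs_lt]
      constructor <;> omega)
    exact hj (sub_eq_zero.1 h0)

instance : (torusMeasure d).IsAddLeftInvariant := by
  unfold torusMeasure; infer_instance

theorem continuous_of_mem_trigPoly {Q : Finset (Fin d → ℤ)} {f : Torus d → ℂ}
    (hf : f ∈ trigPoly Q) : Continuous f := by
  obtain ⟨c, hc⟩ := hf
  rw [funext hc]
  exact continuous_finsetSum _ fun k _ => continuous_const.mul (continuous_character k)

/-- On a fine grid the discrete norm approximates the `L₁` norm of trigonometric polynomials. -/
theorem abs_l1Norm_sub_gridNorm_le {M : ℕ} (hK : 2 * M < K) {Q : Finset (Fin d → ℤ)}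
    (hQ : (Q : Set (Fin d → ℤ)) ⊆ freqBox (fun _ => M)) {f : Torus d → ℂ} (hf : f ∈ trigPoly Q) :
    |l1Norm f - gridNorm (fun g : Fin d → ZMod K => f (torusGrid K g))| ≤
      Q.card * (d * (M * (2 * Real.pi / K))) *
        gridNorm (fun g : Fin d → ZMod K => f (torusGrid K g)) := by
  have hfc := continuous_of_mem_trigPoly hf
  obtain ⟨c, hc⟩ := hf
  have hK0 : (0 : ℝ) < K := by exact_mod_cast NeZero.pos K
  have hG : (0 : ℝ) < Fintype.card (Fin d → ZMod K) := by exact_mod_cast Fintype.card_pos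
  set gn := gridNorm (fun g : Fin d → ZMod K => f (torusGrid K g)) with hgn
  set δ := d * (M * (2 * Real.pi / K)) with hδ
  have hcoef : ∀ k ∈ Q, ‖c k‖ ≤ gn := by
    intro k hk
    have h := norm_coeff_le_gridNorm (G := Fin d → ZMod K) (Q := Q)
      (e := fun k g => character k (torusGrid K g)) (fun k g => norm_character _ _)
      (fun k hk l hl => sum_character_mul_conj K hK (hQ hk) (hQ hl)) c hk
    simpa only [hgn, hc] using h
  have hpt : ∀ x : Torus d,
      ‖∑ g : Fin d → ZMod K, (‖f (torusGrid K g + x)‖ - ‖f (torusGrid K g)‖)‖ ≤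
      Fintype.card (Fin d → ZMod K) * (Q.card * δ * gn) := by
    intro x
    choose g₀ τ hτ hx using fun j => exists_eq_circleGrid_add K (x j)
    set t : Torus d := fun j => ((τ j : ℝ) : AddCircle (2 * Real.pi)) with ht
    have hxt : x = torusGrid K g₀ + t := funext hx
    have hshift : ∑ g : Fin d → ZMod K, ‖f (torusGrid K g + x)‖ =
        ∑ g : Fin d → ZMod K, ‖f (torusGrid K g + t)‖ := by
      rw [← Equiv.sum_comp (Equiv.addRight g₀) (fun g => ‖f (torusGrid K g + t)‖)]
      refine Finset.sum_congr rfl fun g _ => ?_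
      rw [Equiv.coe_addRight, torusGrid_add, hxt, add_assoc]
    rw [Finset.sum_sub_distrib, hshift, ← Finset.sum_sub_distrib, ← nsmul_eq_mul,
      ← Finset.card_univ, ← Finset.sum_const]
    refine (norm_sum_le _ _).trans (Finset.sum_le_sum fun g _ => ?_)
    refine (abs_norm_sub_norm_le _ _).trans ?_
    rw [hc, hc, ← Finset.sum_sub_distrib]
    calc _ ≤ ∑ k ∈ Q, gn * δ := by
          refine (norm_sum_le _ _).trans (Finset.sum_le_sum fun k hk => ?_)
          rw [character_add, show c k * (character k (torusGrid K g) * character k t) -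
            c k * character k (torusGrid K g) =
            c k * character k (torusGrid K g) * (character k t - 1) by ring,
            norm_mul, norm_mul, norm_character, mul_one]
          refine mul_le_mul (hcoef k hk) ?_ (norm_nonneg _) (gridNorm_nonneg _)
          refine (norm_character_coe_sub_one_le k τ).trans ?_
          calc _ ≤ ∑ _j : Fin d, (M * (2 * Real.pi / K) : ℝ) := by
                refine Finset.sum_le_sum fun j _ => mul_le_mul ?_ (hτ j) (abs_nonneg _)
                  (Nat.cast_nonneg _)
                have := hQ hk j
                exact_mod_cast abs_le.2 this
            _ = δ := by simp [hδ]
      _ = _ := by rw [Finset.sum_const, nsmul_eq_mul]; ring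
  have hint : ∀ y : Torus d, Integrable (fun x => ‖f (y + x)‖) (torusMeasure d) := fun y =>
    Continuous.integrable_of_hasCompactSupport (by fun_prop) (HasCompactSupport.of_compactSpace _)
  have hI : ∫ x, ∑ g : Fin d → ZMod K, (‖f (torusGrid K g + x)‖ - ‖f (torusGrid K g)‖)
      ∂(torusMeasure d) = Fintype.card (Fin d → ZMod K) * (l1Norm f - gn) := by
    have hint' : ∀ g : Fin d → ZMod K, Integrable
        (fun x => ‖f (torusGrid K g + x)‖ - ‖f (torusGrid K g)‖) (torusMeasure d) :=
      fun g => (hint _).sub (integrable_const _)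
    rw [integral_finsetSum _ fun g _ => hint' g]
    have : ∀ g : Fin d → ZMod K, ∫ x, (‖f (torusGrid K g + x)‖ - ‖f (torusGrid K g)‖)
        ∂(torusMeasure d) = l1Norm f - ‖f (torusGrid K g)‖ := by
      intro g
      rw [integral_sub (hint _) (integrable_const _),
        integral_add_left_eq_self (fun x => ‖f x‖) (torusGrid K g), integral_const]
      simp [l1Norm]
    simp only [this, Finset.sum_sub_distrib]
    rw [mul_sub, hgn, card_mul_gridNorm]
    simp
  have hfin := norm_integral_le_of_norm_le_const (μ := torusMeasure d)
    (Filter.Eventually.of_forall hpt)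
  rw [hI, probReal_univ, mul_one, norm_mul, Real.norm_of_nonneg hG.le] at hfin
  exact le_of_mul_le_mul_left hfin hG

theorem card_le_of_subset_freqBox {M : ℕ} {Q : Finset (Fin d → ℤ)}
    (hQ : (Q : Set (Fin d → ℤ)) ⊆ freqBox (fun _ => M)) : Q.card ≤ (2 * M + 1) ^ d := by
  have h : Q ⊆ Fintype.piFinset fun _ : Fin d => Finset.Icc (-(M : ℤ)) M := fun k hk => by
    simpa [freqBox] using hQ hk
  refine (Finset.card_le_card h).trans_eq ?_
  simp only [Fintype.card_piFinset, Int.card_Icc, Finset.prod_const, Finset.card_univ,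
    Fintype.card_fin]
  congr 1
  omega

end Grid

end TrigDisc

theorem theorem3p3 (d : ℕ) :
    ∃ C : ℝ, 0 < C ∧
      ∀ n : ℕ, 1 ≤ n →
      ∀ Q : Finset (Fin d → ℤ), Q.Nonempty →
        (Q : Set (Fin d → ℤ)) ⊆ TrigDisc.freqBox (fun _ => 2 ^ n) →
        ∃ (m : ℕ) (ξ : Fin m → TrigDisc.Torus d),
          0 < m ∧ (m : ℝ) ≤ C * (Q.card : ℝ) * (n : ℝ) ^ (7 / 2 : ℝ) ∧
          Function.Injective ξ ∧
          ∀ f ∈ TrigDisc.trigPoly Q,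
            (1 / 2 : ℝ) * TrigDisc.l1Norm f ≤ (1 / (m : ℝ)) * ∑ j, ‖f (ξ j)‖ ∧
            (1 / (m : ℝ)) * ∑ j, ‖f (ξ j)‖ ≤ (3 / 2 : ℝ) * TrigDisc.l1Norm f := by
  open TrigDisc in
  refine ⟨4 * (2400 ^ 2 * (1 + d * (7 + 4 * d))), by positivity, fun n hn Q hQne hQ => ?_⟩
  have hn1 : (1 : ℝ) ≤ n := by exact_mod_cast hn
  set a : ℕ := 6 + d + n + (n + 2) * d with ha
  set K : ℕ := 2 ^ a with hKdef
  have : NeZero K := ⟨by positivity⟩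
  have hK : 2 * 2 ^ n < K := by
    rw [hKdef, ← pow_succ']
    exact Nat.pow_lt_pow_right (by norm_num) (by rw [ha]; omega)
  have hcardQ : Q.card ≤ 2 ^ ((n + 2) * d) := by
    refine (card_le_of_subset_freqBox hQ).trans ?_
    rw [pow_mul]
    refine Nat.pow_le_pow_left ?_ d
    have : 1 ≤ 2 ^ n := Nat.one_le_two_pow
    rw [pow_add]
    omega
  have hfine : (Q.card : ℝ) * (d * ((2 ^ n : ℕ) * (2 * Real.pi / K))) ≤ 1 / 8 := by
    have h1 : (Q.card : ℝ) ≤ 2 ^ ((n + 2) * d) := by exact_mod_cast hcardQ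
    have h2 : (d : ℝ) ≤ 2 ^ d := by exact_mod_cast Nat.lt_two_pow_self.le
    have h3 : 2 * Real.pi ≤ 8 := by linarith [Real.pi_le_four]
    calc (Q.card : ℝ) * (d * ((2 ^ n : ℕ) * (2 * Real.pi / K)))
        ≤ 2 ^ ((n + 2) * d) * (2 ^ d * ((2 ^ n : ℕ) * (8 / K))) := by gcongr
      _ = 1 / 8 := by
          rw [hKdef, ha]
          push_cast
          simp only [pow_add]
          field_simp
          norm_num
  have hQ1 : (1 : ℝ) ≤ Q.card := by exact_mod_cast hQne.card_pos
  have horth : ∀ k ∈ Q, ∀ l ∈ Q, ∑ g : Fin d → ZMod K, character k (torusGrid K g) *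
      starRingEnd ℂ (character l (torusGrid K g)) =
      if k = l then (Fintype.card (Fin d → ZMod K) : ℂ) else 0 :=
    fun k hk l hl => sum_character_mul_conj K hK (hQ hk) (hQ hl)
  set e : (Fin d → ℤ) → (Fin d → ZMod K) → ℂ := fun k g => character k (torusGrid K g) with he
  have he1 : ∀ k g, ‖e k g‖ = 1 := fun k g => norm_character _ _
  obtain ⟨S, hS, hScard, hSf⟩ := exists_discretizing_subset (D := dirichletKernel Q e) hQ1
    (norm_dirichletKernel_le he1) (fun y => (sum_norm_dirichletKernel_sq he1 horth y).le)
  have hs : (0 : ℝ) < S.card := by exact_mod_cast hS.card_pos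
  refine ⟨S.card, fun i => torusGrid K (S.equivFin.symm i), hS.card_pos, ?_, ?_, ?_⟩
  · refine hScard.trans ?_
    have hlog : Real.log (2 * Fintype.card (Fin d → ZMod K)) ≤ (1 + d * (7 + 4 * d)) * n := by
      have h1 : (2 * Fintype.card (Fin d → ZMod K) : ℝ) = 2 ^ (1 + a * d) := by
        simp [ZMod.card, hKdef, pow_add, pow_mul]
      rw [h1, Real.log_pow]
      have h2 : Real.log 2 ≤ 1 := by linarith [Real.log_two_lt_d9]
      have h3 : (a : ℝ) ≤ (7 + 4 * d) * n := by
        rw [ha]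
        push_cast
        have : (d : ℝ) ≤ d * n := le_mul_of_one_le_right (Nat.cast_nonneg d) hn1
        linarith
      calc ((1 + a * d : ℕ) : ℝ) * Real.log 2 ≤ ((1 + a * d : ℕ) : ℝ) * 1 := by gcongr
        _ ≤ 1 * n + ((7 + 4 * d) * n) * d := by push_cast; rw [mul_one]; gcongr; linarith
        _ = _ := by ring
    have hpow : (n : ℝ) ≤ (n : ℝ) ^ (7 / 2 : ℝ) :=
      Real.self_le_rpow_of_one_le hn1 (by norm_num)
    calc _ ≤ 4 * (2400 ^ 2 * ((1 + d * (7 + 4 * d)) * (n : ℝ) ^ (7 / 2 : ℝ)) * (Q.card : ℝ)) := by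
          gcongr
          exact hlog.trans (by gcongr)
      _ = _ := by ring
  · exact (torusGrid_injective K).comp
      (Subtype.val_injective.comp S.equivFin.symm.injective)
  · intro f hf
    have hl := abs_l1Norm_sub_gridNorm_le K hK hQ hf
    have hsum : ∑ i, ‖f (torusGrid K (S.equivFin.symm i))‖ = ∑ g ∈ S, ‖f (torusGrid K g)‖ := by
      rw [Equiv.sum_comp S.equivFin.symm (fun g : S => ‖f (torusGrid K g)‖)]
      exact Finset.sum_coe_sort S fun g => ‖f (torusGrid K g)‖
    obtain ⟨c, hc⟩ := hf
    have hr : (fun g => f (torusGrid K g)) ∈ reproduced (dirichletKernel Q e) := by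
      have := sum_mem_reproduced horth c
      simpa only [hc] using this
    have hd := hSf _ hr
    rw [hsum]
    set gn := gridNorm (fun g : Fin d → ZMod K => f (torusGrid K g)) with hgn
    have hg0 : 0 ≤ gn := gridNorm_nonneg _
    have hl' := hl.trans (mul_le_mul_of_nonneg_right hfine hg0)
    rw [one_div_mul_eq_div (S.card : ℝ), le_div_iff₀ hs, div_le_iff₀ hs]
    rw [abs_le] at hl' hd
    have u1 := mul_le_mul_of_nonneg_right hl'.1 hs.le
    have u2 := mul_le_mul_of_nonneg_right hl'.2 hs.le
    have u3 := mul_nonneg hg0 hs.le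
    constructor <;> linarith
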